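/- Let $n\ge m\ge 2$ be integers. For a real $n\times m$ matrix $A$ with nonzero rows $a_1,\dots,a_n$ put $$\theta(A)=\max_{x\in\mathbb{R}^m\setminus\{0\}}\ \min_{1\le i\le n}\ \arccos\frac{a_i\cdot x}{\|a_i\|\,\|x\|},\qquad \mathscr{C}(A)=|\cos\theta(A)|^{-1}\in[1,\infty].$$ Let $A$ be a uniform random $n\times m$ matrix, that is, a random matrix whose $n$ rows are independent and uniformly distributed on the unit sphere $\mathrm{S}^{m-1}$ of $\mathbb{R}^m$. Then $$\lim_{t\to\infty}\frac{\log \mathbf{P}\left[\log\mathscr{C}(A)\ge t\right]}{t}=-1 .$$ So the exponential decay rate of the tail $\mathbf{P}\left[\log\mathscr{C}(A)\ge t\right]$ is exactly $-1$. -/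

import Mathlib

open MeasureTheory ProbabilityTheory Filter Topology

namespace LinearFeasibility

/-- The `i`-th row of a real `n × m` matrix, as a vector of Euclidean space `ℝᵐ`. -/
def row {n m : ℕ} (A : Matrix (Fin n) (Fin m) ℝ) (i : Fin n) : EuclideanSpace ℝ (Fin m) :=
  WithLp.toLp 2 (A i)

/-- `θ(A, x)`, the smallest angle between `x` and a row of `A`. -/
noncomputable def minAngle {n m : ℕ} (A : Matrix (Fin n) (Fin m) ℝ)
    (x : EuclideanSpace ℝ (Fin m)) : ℝ :=
  ⨅ i : Fin n, InnerProductGeometry.angle (row A i) x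

/-- `θ(A)`, the supremum (in fact, maximum) of `θ(A, x)` over all nonzero vectors `x`. -/
noncomputable def maxMinAngle {n m : ℕ} (A : Matrix (Fin n) (Fin m) ℝ) : ℝ :=
  ⨆ x : {x : EuclideanSpace ℝ (Fin m) // x ≠ 0}, minAngle A x

/-- The condition number `|cos θ(A)|⁻¹`. It takes values in `[0, ∞]`, and it is infinite when
`cos θ(A) = 0`, that is, when `A` is ill-posed. -/
noncomputable def condNumber {n m : ℕ} (A : Matrix (Fin n) (Fin m) ℝ) : ENNReal :=
  (ENNReal.ofReal |Real.cos (maxMinAngle A)|)⁻¹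

/-- The uniform probability measure on the unit sphere of `ℝᵐ` (for `1 ≤ m`): the surface measure
divided by its total mass. -/
noncomputable def uniformSphere (m : ℕ) :
    Measure (Metric.sphere (0 : EuclideanSpace ℝ (Fin m)) 1) :=
  ((volume : Measure (EuclideanSpace ℝ (Fin m))).toSphere Set.univ)⁻¹ •
    (volume : Measure (EuclideanSpace ℝ (Fin m))).toSphere

/-- `A` is a uniform random `n × m` matrix: its rows are independent random vectors with the
uniform distribution on the unit sphere of `ℝᵐ`. -/
def IsUniformRandomMatrix {Ω : Type*} [MeasurableSpace Ω] {n m : ℕ}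
    (A : Ω → Matrix (Fin n) (Fin m) ℝ) (P : Measure Ω) : Prop :=
  ∃ a : Fin n → Ω → Metric.sphere (0 : EuclideanSpace ℝ (Fin m)) 1,
    (∀ ω i, row (A ω) i = (a i ω : EuclideanSpace ℝ (Fin m))) ∧
    (∀ i, HasLaw (a i) (uniformSphere m) P) ∧
    iIndepFun a P

end LinearFeasibility

/-! Up to constants, `P[|cos θ(A)| ≤ δ]` equals `δ` for small `δ`; with `δ = e^{-t}` the constants
vanish after taking logarithms and dividing by `t`. The event is sandwiched between instances of
`NearIllPosed`, a condition on inner products alone. Upper bound: a near ill-posed family has a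
convex hull with a frontier point within `2δ` of the origin. Such a point is a convex combination of
at most `m` vectors, so dividing by the largest weight puts some `a j` within `2mδ` of the span of
fewer than `m` others (`NearIllPosed.exists_norm_add_sum_le`). Given the others, `a j` lies in a
band around an equator, of probability `O(δ)`. Lower bound: given `m - 1` rows, an `m`-th one falls
with probability at least `cε` in the band around a hyperplane through them. Then `m` rows are
nearly orthogonal to one direction, and some change of signs makes the family near ill-posed
(`exists_nearIllPosed_smul`). Sign changes preserve the law, so a union bound over them costs only a
constant. -/

namespace LinearFeasibility

/-- The vectors `a i` are within `δ` of being ill-posed: they are contained in a half-space up to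
an error `δ`, and they are contained in no half-space with a margin larger than `δ`. -/
def NearIllPosed {n m : ℕ} (a : Fin n → EuclideanSpace ℝ (Fin m)) (δ : ℝ) : Prop :=
  (∃ x : EuclideanSpace ℝ (Fin m), ‖x‖ = 1 ∧ ∀ i, inner ℝ (a i) x ≤ δ) ∧
    ∀ y : EuclideanSpace ℝ (Fin m), ‖y‖ = 1 → ∃ i, -δ ≤ inner ℝ (a i) y

/-! ### Angles and the condition number. -/

lemma minAngle_le_angle {n m : ℕ} (A : Matrix (Fin n) (Fin m) ℝ)
    (x : EuclideanSpace ℝ (Fin m)) (i : Fin n) :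
    minAngle A x ≤ InnerProductGeometry.angle (row A i) x :=
  ciInf_le (Set.finite_range _).bddBelow i

lemma minAngle_le_pi {n m : ℕ} [NeZero n] (A : Matrix (Fin n) (Fin m) ℝ)
    (x : EuclideanSpace ℝ (Fin m)) : minAngle A x ≤ Real.pi :=
  (minAngle_le_angle A x 0).trans (InnerProductGeometry.angle_le_pi _ _)

lemma minAngle_nonneg {n m : ℕ} (A : Matrix (Fin n) (Fin m) ℝ)
    (x : EuclideanSpace ℝ (Fin m)) : 0 ≤ minAngle A x :=
  Real.iInf_nonneg fun _ => InnerProductGeometry.angle_nonneg _ _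

lemma minAngle_le_maxMinAngle {n m : ℕ} [NeZero n] (A : Matrix (Fin n) (Fin m) ℝ)
    {x : EuclideanSpace ℝ (Fin m)} (hx : x ≠ 0) : minAngle A x ≤ maxMinAngle A :=
  le_ciSup (f := fun x : {x : EuclideanSpace ℝ (Fin m) // x ≠ 0} => minAngle A x)
    ⟨Real.pi, by rintro _ ⟨x, rfl⟩; exact minAngle_le_pi A x⟩ ⟨x, hx⟩

lemma maxMinAngle_nonneg {n m : ℕ} (A : Matrix (Fin n) (Fin m) ℝ) : 0 ≤ maxMinAngle A :=
  Real.iSup_nonneg fun _ => minAngle_nonneg _ _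

lemma maxMinAngle_le_pi {n m : ℕ} [NeZero n] (A : Matrix (Fin n) (Fin m) ℝ) :
    maxMinAngle A ≤ Real.pi :=
  Real.iSup_le (fun _ => minAngle_le_pi _ _) Real.pi_pos.le

lemma cos_angle_row {n m : ℕ} {A : Matrix (Fin n) (Fin m) ℝ} (hA : ∀ i, ‖row A i‖ = 1)
    {x : EuclideanSpace ℝ (Fin m)} (hx : ‖x‖ = 1) (i : Fin n) :
    Real.cos (InnerProductGeometry.angle (row A i) x) = inner ℝ (row A i) x := by
  rw [InnerProductGeometry.cos_angle, hA, hx]; simp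

lemma exists_angle_eq_minAngle {n m : ℕ} [NeZero n] (A : Matrix (Fin n) (Fin m) ℝ)
    (x : EuclideanSpace ℝ (Fin m)) :
    ∃ i, InnerProductGeometry.angle (row A i) x = minAngle A x :=
  exists_eq_ciInf_of_finite

lemma NearIllPosed.abs_cos_le {n m : ℕ} [NeZero n] {A : Matrix (Fin n) (Fin m) ℝ}
    (hA : ∀ i, ‖row A i‖ = 1) {δ : ℝ} (h : NearIllPosed (row A) δ) :
    |Real.cos (maxMinAngle A)| ≤ δ := by
  obtain ⟨⟨x, hx, hxδ⟩, hy⟩ := h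
  have hx0 : x ≠ 0 := by rintro rfl; simp at hx
  rw [abs_le]
  constructor
  · by_contra! hlt
    have hc : Real.cos (maxMinAngle A) < -δ := hlt
    have hδ1 : -δ ≤ 1 := by
      obtain ⟨i, hi⟩ := hy x hx
      refine hi.trans ((real_inner_le_norm _ _).trans ?_)
      simp [hA, hx]
    have hθ : Real.arccos (-δ) < maxMinAngle A := by
      rw [← Real.arccos_cos (maxMinAngle_nonneg A) (maxMinAngle_le_pi A)]
      exact Real.arccos_lt_arccos (Real.neg_one_le_cos _) hc hδ1
    have : Nonempty {x : EuclideanSpace ℝ (Fin m) // x ≠ 0} := ⟨⟨x, hx0⟩⟩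
    refine absurd hθ (not_lt.2 (ciSup_le ?_))
    rintro ⟨y, hy0⟩
    have hyn : ‖(‖y‖⁻¹ : ℝ) • y‖ = 1 := norm_smul_inv_norm (𝕜 := ℝ) hy0
    obtain ⟨i, hi⟩ := hy _ hyn
    refine (minAngle_le_angle A y i).trans ?_
    rw [← InnerProductGeometry.angle_smul_right_of_pos _ _ (inv_pos.2 (norm_pos_iff.2 hy0)),
      ← Real.arccos_cos (InnerProductGeometry.angle_nonneg _ _)
        (InnerProductGeometry.angle_le_pi (row A i) _), cos_angle_row hA hyn]
    exact Real.arccos_le_arccos hi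
  · obtain ⟨i, hi⟩ := exists_angle_eq_minAngle A x
    refine le_trans ?_ (hxδ i)
    rw [← cos_angle_row hA hx, hi]
    exact Real.cos_le_cos_of_nonneg_of_le_pi (minAngle_nonneg _ _) (maxMinAngle_le_pi A)
      (minAngle_le_maxMinAngle A hx0)

/-- The strict inequality yields `x` from the supremum without proving that it is attained. -/
lemma nearIllPosed_of_abs_cos_lt {n m : ℕ} [NeZero n] {A : Matrix (Fin n) (Fin m) ℝ}
    (hA : ∀ i, ‖row A i‖ = 1) (hm : 0 < m) {δ : ℝ} (hδ : δ ≤ 1)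
    (h : |Real.cos (maxMinAngle A)| < δ) : NearIllPosed (row A) δ := by
  have : NeZero m := ⟨hm.ne'⟩
  rw [abs_lt] at h
  constructor
  · have hθ : Real.arccos δ < maxMinAngle A := by
      rw [← Real.arccos_cos (maxMinAngle_nonneg A) (maxMinAngle_le_pi A)]
      exact Real.arccos_lt_arccos (Real.neg_one_le_cos _) h.2 hδ
    have : Nonempty {x : EuclideanSpace ℝ (Fin m) // x ≠ 0} :=
      ⟨⟨EuclideanSpace.single 0 1, by simp⟩⟩
    obtain ⟨⟨x, hx0⟩, hx⟩ := exists_lt_of_lt_ciSup hθ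
    have hxn : ‖(‖x‖⁻¹ : ℝ) • x‖ = 1 := norm_smul_inv_norm (𝕜 := ℝ) hx0
    refine ⟨_, hxn, fun i => ?_⟩
    rw [← cos_angle_row hA hxn,
      InnerProductGeometry.angle_smul_right_of_pos _ _ (inv_pos.2 (norm_pos_iff.2 hx0))]
    have hδ' : -1 ≤ δ := by linarith [h.1, h.2]
    rw [← Real.cos_arccos hδ' hδ]
    exact Real.cos_le_cos_of_nonneg_of_le_pi (Real.arccos_nonneg _)
      (InnerProductGeometry.angle_le_pi _ _) (hx.le.trans (minAngle_le_angle A x i))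
  · intro y hy
    have hy0 : y ≠ 0 := by rintro rfl; simp at hy
    obtain ⟨i, hi⟩ := exists_angle_eq_minAngle A y
    refine ⟨i, h.1.le.trans ?_⟩
    rw [← cos_angle_row hA hy, hi]
    exact Real.cos_le_cos_of_nonneg_of_le_pi (minAngle_nonneg _ _) (maxMinAngle_le_pi A)
      (minAngle_le_maxMinAngle A hy0)

lemma le_log_condNumber_iff {n m : ℕ} (A : Matrix (Fin n) (Fin m) ℝ) (t : ℝ) :
    (t : EReal) ≤ ENNReal.log (condNumber A) ↔ |Real.cos (maxMinAngle A)| ≤ Real.exp (-t) := by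
  have ht : (t : EReal) = ENNReal.log (ENNReal.ofReal (Real.exp t)) := by
    rw [ENNReal.log_ofReal_of_pos (Real.exp_pos t), Real.log_exp]
  rw [ht, ENNReal.log_le_log_iff, condNumber, ENNReal.le_inv_iff_le_inv,
    ← ENNReal.ofReal_inv_of_pos (Real.exp_pos t), ← Real.exp_neg,
    ENNReal.ofReal_le_ofReal_iff (Real.exp_pos _).le]

/-! ### Convex geometry of near ill-posed families. -/

/-- Take `p` nearest to the origin. Every `a i` has inner product at least `‖p‖²` with `p`, so
testing `h` on `-p/‖p‖` gives `‖p‖ ≤ δ`. -/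
lemma exists_mem_convexHull_norm_le {n m : ℕ} (hn : 0 < n)
    {a : Fin n → EuclideanSpace ℝ (Fin m)} {δ : ℝ} (hδ : 0 ≤ δ)
    (h : ∀ y : EuclideanSpace ℝ (Fin m), ‖y‖ = 1 → ∃ i, -δ ≤ inner ℝ (a i) y) :
    ∃ p ∈ convexHull ℝ (Set.range a), ‖p‖ ≤ δ := by
  have : NeZero n := ⟨hn.ne'⟩
  have hK : IsCompact (convexHull ℝ (Set.range a)) := (Set.finite_range a).isCompact_convexHull (𝕜 := ℝ)
  have hconv : Convex ℝ (convexHull ℝ (Set.range a)) := convex_convexHull _ _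
  obtain ⟨p, hp, hmin⟩ := exists_norm_eq_iInf_of_complete_convex
    ((Set.range_nonempty a).convexHull) hK.isComplete hconv 0
  rw [norm_eq_iInf_iff_real_inner_le_zero hconv hp] at hmin
  refine ⟨p, hp, ?_⟩
  rcases eq_or_ne p 0 with rfl | hp0
  · simpa using hδ
  have hpn : ‖-((‖p‖⁻¹ : ℝ) • p)‖ = 1 := by
    rw [norm_neg]; exact norm_smul_inv_norm (𝕜 := ℝ) hp0
  obtain ⟨i, hi⟩ := h _ hpn
  have h1 := hmin (a i) (subset_convexHull _ _ ⟨i, rfl⟩)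
  rw [zero_sub, inner_neg_left, inner_sub_right, real_inner_self_eq_norm_sq,
    real_inner_comm] at h1
  have hpos : 0 < ‖p‖ := norm_pos_iff.2 hp0
  rw [inner_neg_right, inner_smul_right, neg_le_neg_iff] at hi
  have h2 : ‖p‖ ≤ ‖p‖⁻¹ * inner ℝ (a i) p := by
    rw [le_inv_mul_iff₀ hpos]; nlinarith
  linarith

lemma inner_le_of_mem_convexHull {E : Type*} [NormedAddCommGroup E] [InnerProductSpace ℝ E]
    {s : Set E} {x : E} {δ : ℝ} (h : ∀ y ∈ s, inner ℝ y x ≤ δ) {p : E}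
    (hp : p ∈ convexHull ℝ s) : inner ℝ p x ≤ δ := by
  have hc : Convex ℝ {y : E | inner ℝ y x ≤ δ} := by
    simpa [real_inner_comm] using
      convex_halfSpace_le (innerSL ℝ x).toLinearMap.isLinear δ
  exact convexHull_min h hc hp

/-- The connected ball of radius `2δ` contains a point of the hull and also `2δ x`, which lies
outside it, so it meets the frontier. -/
lemma NearIllPosed.exists_frontier {n m : ℕ} (hn : 0 < n)
    {a : Fin n → EuclideanSpace ℝ (Fin m)} {δ : ℝ} (hδ : 0 < δ) (h : NearIllPosed a δ) :
    ∃ p ∈ frontier (convexHull ℝ (Set.range a)), ‖p‖ ≤ 2 * δ := by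
  obtain ⟨⟨x, hx, hxδ⟩, hy⟩ := h
  obtain ⟨p, hp, hpδ⟩ := exists_mem_convexHull_norm_le hn hδ.le hy
  have hball : IsPreconnected (Metric.closedBall (0 : EuclideanSpace ℝ (Fin m)) (2 * δ)) :=
    (convex_closedBall _ _).isPreconnected
  have hq : (2 * δ) • x ∉ convexHull ℝ (Set.range a) := fun hq => by
    have := inner_le_of_mem_convexHull (x := x) (δ := δ) (by rintro _ ⟨i, rfl⟩; exact hxδ i) hq
    rw [inner_smul_left, real_inner_self_eq_norm_sq, hx] at this
    simp at this
    linarith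
  have hK : IsClosed (convexHull ℝ (Set.range a)) :=
    ((Set.finite_range a).isCompact_convexHull (𝕜 := ℝ)).isClosed
  by_contra! hcon
  have hsub : Metric.closedBall 0 (2 * δ) ⊆
      interior (convexHull ℝ (Set.range a)) ∪ (convexHull ℝ (Set.range a))ᶜ := fun z hz => by
    by_contra hz'
    simp only [Set.mem_union, Set.mem_compl_iff, not_or, not_not] at hz'
    exact (hcon z ⟨subset_closure hz'.2, hz'.1⟩).not_ge (by simpa using hz)
  obtain ⟨z, -, hz1, hz2⟩ := hball _ _ isOpen_interior hK.isOpen_compl hsub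
    (by
      have hp2 : p ∈ Metric.closedBall (0 : EuclideanSpace ℝ (Fin m)) (2 * δ) := by
        simp; linarith
      exact ⟨p, hp2, (hsub hp2).resolve_right fun h => h hp⟩)
    ⟨_, by simp [norm_smul, hx, abs_of_pos hδ], hq⟩
  exact hz2 (interior_subset hz1)

/-- A frontier point of the convex hull of finitely many points in dimension `d` is a convex
combination of at most `d` of them. -/
lemma exists_convexCombination_of_mem_frontier {n : ℕ} {E : Type*} [NormedAddCommGroup E]
    [NormedSpace ℝ E] [FiniteDimensional ℝ E] {a : Fin n → E} {p : E}
    (hp : p ∈ frontier (convexHull ℝ (Set.range a))) :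
    ∃ (s : Finset (Fin n)) (w : Fin n → ℝ), s.card ≤ Module.finrank ℝ E ∧ (∀ i, 0 ≤ w i) ∧
      ∑ i ∈ s, w i = 1 ∧ ∑ i ∈ s, w i • a i = p := by
  classical
  have hK : IsClosed (convexHull ℝ (Set.range a)) :=
    ((Set.finite_range a).isCompact_convexHull (𝕜 := ℝ)).isClosed
  obtain ⟨ι, _, z, w, hz, hind, hw, hw1, hwp⟩ :=
    eq_pos_convex_span_of_mem_convexHull (hK.frontier_subset hp)
  have hcard : Fintype.card ι ≤ Module.finrank ℝ E := by
    -- Otherwise the points form an affine basis, and positive barycentric coordinates put `p` in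
    -- the interior.
    by_contra! hlt
    have hle : Fintype.card ι ≤ Module.finrank ℝ E + 1 :=
      hind.card_le_finrank_succ.trans (by gcongr; exact Submodule.finrank_le _)
    have htop : affineSpan ℝ (Set.range z) = ⊤ :=
      hind.affineSpan_eq_top_iff_card_eq_finrank_add_one.2 (by omega)
    let b : AffineBasis ι ℝ E := ⟨z, hind, htop⟩
    have hmem : p ∈ interior (convexHull ℝ (Set.range b)) := by
      rw [AffineBasis.interior_convexHull]
      intro i
      have hpc : p = Finset.univ.affineCombination ℝ b w := by
        rw [Finset.affineCombination_eq_linear_combination _ _ _ hw1]; exact hwp.symm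
      rw [hpc, b.coord_apply_combination_of_mem (Finset.mem_univ i) hw1]
      exact hw i
    exact hp.2 (interior_mono (convexHull_mono hz) hmem)
  choose f hf using fun i => hz ⟨i, rfl⟩
  have hfi : Function.Injective f := fun i j hij => hind.injective (by rw [← hf, ← hf, hij])
  refine ⟨Finset.univ.image f, fun k => ∑ i, if f i = k then w i else 0, ?_, ?_, ?_, ?_⟩
  · rw [Finset.card_image_of_injective _ hfi]; simpa using hcard
  · exact fun k => Finset.sum_nonneg fun i _ => by split_ifs <;> simp [(hw i).le]
  · rw [Finset.sum_image hfi.injOn]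
    simpa [hfi.eq_iff] using hw1
  · rw [Finset.sum_image hfi.injOn]
    simpa [hfi.eq_iff, hf] using hwp

/-- If unit vectors are nearly ill-posed, then one of them is near the span of fewer than `m`
others. -/
lemma NearIllPosed.exists_norm_add_sum_le {n m : ℕ} (hn : 0 < n)
    {a : Fin n → EuclideanSpace ℝ (Fin m)} {δ : ℝ} (hδ : 0 < δ) (h : NearIllPosed a δ) :
    ∃ (j : Fin n) (s : Finset (Fin n)), j ∉ s ∧ s.card < m ∧ ∃ c : Fin n → Set.Icc (0 : ℝ) 1,
      ‖a j + ∑ i ∈ s, (c i : ℝ) • a i‖ ≤ 2 * m * δ := by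
  obtain ⟨p, hp, hpδ⟩ := h.exists_frontier hn hδ
  obtain ⟨s, w, hs, hw0, hw1, hwp⟩ := exists_convexCombination_of_mem_frontier hp
  rw [finrank_euclideanSpace_fin] at hs
  have hsne : s.Nonempty := Finset.nonempty_of_sum_ne_zero (by rw [hw1]; exact one_ne_zero)
  -- The largest weight is at least `1/m`, and dividing by it keeps the other coefficients in the
  -- compact interval `[0, 1]`, which later makes the event closed.
  obtain ⟨j, hjs, hj⟩ := s.exists_max_image w hsne
  have hle : 1 ≤ m * w j := by
    calc (1 : ℝ) = ∑ i ∈ s, w i := hw1.symm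
      _ ≤ s.card • w j := Finset.sum_le_card_nsmul _ _ _ hj
      _ ≤ m * w j := by
        rw [nsmul_eq_mul]; gcongr; exact hw0 j
  have hwj : 0 < w j := by
    by_contra! hneg
    nlinarith [hw0 j, (Nat.cast_nonneg m : (0 : ℝ) ≤ m)]
  refine ⟨j, s.erase j, Finset.notMem_erase _ _, ?_,
    fun i => Set.projIcc 0 1 zero_le_one (w i / w j), ?_⟩
  · rw [Finset.card_erase_of_mem hjs]
    have := hsne.card_pos
    omega
  have hsum : a j + ∑ i ∈ s.erase j,
      ((Set.projIcc (0 : ℝ) 1 zero_le_one (w i / w j) : Set.Icc (0 : ℝ) 1) : ℝ) • a i =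
      (w j)⁻¹ • p := by
    rw [← hwp, ← Finset.add_sum_erase _ _ hjs, smul_add, Finset.smul_sum, smul_smul,
      inv_mul_cancel₀ hwj.ne', one_smul]
    congr 1
    refine Finset.sum_congr rfl fun i hi => ?_
    rw [Set.projIcc_of_mem zero_le_one
      ⟨div_nonneg (hw0 i) hwj.le, (div_le_one hwj).2 (hj i (Finset.mem_of_mem_erase hi))⟩,
      smul_smul]
    change (w i / w j) • a i = _
    rw [div_eq_inv_mul]
  rw [hsum, norm_smul, norm_inv, Real.norm_of_nonneg hwj.le, inv_mul_le_iff₀ hwj]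
  nlinarith

/-- The projections of the `m` vectors to `xᗮ`, of dimension `m - 1`, are linearly dependent. They
are the rows of `M`, which is singular because it kills `x`. -/
lemma exists_sum_smul_eq {m : ℕ} (b : Fin m → EuclideanSpace ℝ (Fin m))
    {x : EuclideanSpace ℝ (Fin m)} (hx : ‖x‖ = 1) :
    ∃ d : Fin m → ℝ, d ≠ 0 ∧ ∑ i, d i • b i = (∑ i, d i * inner ℝ (b i) x) • x := by
  let M : Matrix (Fin m) (Fin m) ℝ := Matrix.of fun i k => b i k - inner ℝ (b i) x * x k
  have hx0 : x ≠ 0 := by rintro rfl; simp at hx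
  have hsq : ∑ k, x k * x k = 1 := by
    have := real_inner_self_eq_norm_sq x
    rw [hx, PiLp.inner_apply] at this
    simpa [← sq] using this
  have hM : ∃ v ≠ 0, M.mulVec v = 0 := by
    refine ⟨x.ofLp, fun h => hx0 (by ext k; simp [h]), ?_⟩
    ext i
    have hb : inner ℝ (b i) x = ∑ k, b i k * x k := by
      rw [PiLp.inner_apply]; simp [mul_comm]
    simp only [Matrix.mulVec, dotProduct, M, Matrix.of_apply, sub_mul, Finset.sum_sub_distrib,
      mul_assoc, ← Finset.mul_sum, hsq, Pi.zero_apply]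
    rw [hb]; ring
  obtain ⟨d, hd, hdM⟩ := Matrix.exists_vecMul_eq_zero_iff.2 (Matrix.exists_mulVec_eq_zero_iff.1 hM)
  refine ⟨d, hd, ?_⟩
  ext k
  have := congrFun hdM k
  simp only [Matrix.vecMul, dotProduct, M, Matrix.of_apply, Pi.zero_apply, mul_sub,
    Finset.sum_sub_distrib] at this
  simp only [WithLp.ofLp_sum, WithLp.ofLp_smul, Finset.sum_apply, Pi.smul_apply, smul_eq_mul,
    Finset.sum_mul]
  linarith [Finset.sum_congr rfl fun i (_ : i ∈ Finset.univ) =>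
    mul_assoc (d i) (inner ℝ (b i) x) (x k)]

/-- If `m` of the vectors are nearly orthogonal to a common direction, then the vectors are nearly
ill-posed after suitable changes of sign. -/
lemma exists_nearIllPosed_smul {n m : ℕ} (hm : m ≤ n) (a : Fin n → EuclideanSpace ℝ (Fin m))
    {x : EuclideanSpace ℝ (Fin m)} (hx : ‖x‖ = 1) {ε : ℝ} (hε : 0 ≤ ε)
    (h : ∀ i : Fin m, |inner ℝ (a (Fin.castLE hm i)) x| ≤ ε) :
    ∃ s : Fin n → ℤˣ, NearIllPosed (fun i => s i • a i) ε := by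
  obtain ⟨d, hd, hsum⟩ := exists_sum_smul_eq (fun i => a (Fin.castLE hm i)) hx
  -- On the first `m` indices the sign turns `d i` into `|d i|`; on the others it makes the inner
  -- product with `x` nonpositive.
  let s : Fin n → ℤˣ := fun i =>
    if hi : (i : ℕ) < m then (if 0 ≤ d ⟨i, hi⟩ then 1 else -1)
    else (if inner ℝ (a i) x ≤ 0 then 1 else -1)
  have hsi : ∀ i : Fin m, s (Fin.castLE hm i) = if 0 ≤ d i then 1 else -1 := fun i => by
    simp [s]
  refine ⟨s, ⟨x, hx, fun i => ?_⟩, fun y hy => ?_⟩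
  · by_cases hi : (i : ℕ) < m
    · have h1 := abs_le.1 (h ⟨i, hi⟩)
      have h2 : Fin.castLE hm ⟨i, hi⟩ = i := rfl
      rw [h2] at h1
      rcases Int.units_eq_one_or (s i) with h3 | h3 <;> simp [h3] <;> linarith
    · by_cases h0 : inner ℝ (a i) x ≤ 0
      · simp [s, hi, h0, h0.trans hε]
      · simp [s, hi, h0]; linarith
  -- The combination with weights `|d i|` would have inner product below `-ε ∑ |d i|` with `y`, yet
  -- it is a multiple of `x` of norm at most `ε ∑ |d i|`.
  · by_contra! hcon
    have hS : 0 < ∑ i, |d i| := by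
      obtain ⟨i, hi⟩ := Function.ne_iff.1 hd
      exact Finset.sum_pos' (fun i _ => abs_nonneg _) ⟨i, Finset.mem_univ _, abs_pos.2 hi⟩
    have h1 : inner ℝ (∑ i, d i • a (Fin.castLE hm i)) y < -ε * ∑ i, |d i| := by
      rw [sum_inner, Finset.mul_sum]
      have hle : ∀ i : Fin m, inner ℝ (d i • a (Fin.castLE hm i)) y =
          |d i| * inner ℝ (s (Fin.castLE hm i) • a (Fin.castLE hm i)) y := fun i => by
        rw [hsi]
        split_ifs with h0
        · simp [abs_of_nonneg h0, inner_smul_left]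
        · simp [abs_of_neg (not_le.1 h0), inner_smul_left]
      obtain ⟨i, hi⟩ := Function.ne_iff.1 hd
      refine Finset.sum_lt_sum (fun i _ => ?_) ⟨i, Finset.mem_univ _, ?_⟩
      · rw [hle]; nlinarith [hcon (Fin.castLE hm i), abs_nonneg (d i)]
      · rw [hle]; nlinarith [hcon (Fin.castLE hm i), abs_pos.2 hi]
    have h2 : |inner ℝ (∑ i, d i • a (Fin.castLE hm i)) y| ≤ ε * ∑ i, |d i| := by
      refine (abs_real_inner_le_norm _ _).trans ?_
      rw [hsum, hy, norm_smul, hx, mul_one, mul_one, Real.norm_eq_abs, Finset.mul_sum]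
      refine (Finset.abs_sum_le_sum_abs _ _).trans (Finset.sum_le_sum fun i _ => ?_)
      rw [abs_mul, mul_comm]
      exact mul_le_mul_of_nonneg_right (h i) (abs_nonneg _)
    linarith [(abs_le.1 h2).1]

/-! ### Uniform measure of bands on the sphere. -/

open scoped Pointwise

lemma exists_orthonormalBasis_apply_eq {m : ℕ} {x : EuclideanSpace ℝ (Fin m)} (hx : ‖x‖ = 1)
    (i₀ : Fin m) : ∃ b : OrthonormalBasis (Fin m) ℝ (EuclideanSpace ℝ (Fin m)), b i₀ = x := by
  obtain ⟨b, hb⟩ := Orthonormal.exists_orthonormalBasis_extension_of_card_eq (𝕜 := ℝ)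
    (E := EuclideanSpace ℝ (Fin m)) (ι := Fin m) (by simp) (v := fun _ => x) (s := {i₀})
    ⟨fun _ => hx, fun i j hij => absurd (Subsingleton.elim i j) hij⟩
  exact ⟨b, hb i₀ rfl⟩

lemma volume_orthonormalBasis_box {m : ℕ}
    (b : OrthonormalBasis (Fin m) ℝ (EuclideanSpace ℝ (Fin m))) (l u : Fin m → ℝ) :
    volume {y | ∀ i, inner ℝ (b i) y ∈ Set.Icc (l i) (u i)} =
      ∏ i, ENNReal.ofReal (u i - l i) := by
  have hmp : MeasurePreserving (fun y => (b.repr y).ofLp) volume volume :=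
    (PiLp.volume_preserving_ofLp (Fin m)).comp b.measurePreserving_repr
  have hset : {y | ∀ i, inner ℝ (b i) y ∈ Set.Icc (l i) (u i)} =
      (fun y => (b.repr y).ofLp) ⁻¹' Set.Icc l u := by
    ext y
    simp [b.repr_apply_apply, Pi.le_def, forall_and]
  rw [hset, hmp.measure_preimage measurableSet_Icc.nullMeasurableSet, Real.volume_Icc_pi]

lemma toSphere_univ_ne_zero {m : ℕ} (hm : 0 < m) :
    (volume : Measure (EuclideanSpace ℝ (Fin m))).toSphere Set.univ ≠ 0 := by
  have : Nonempty (Fin m) := ⟨⟨0, hm⟩⟩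
  rw [Ne, Measure.measure_univ_eq_zero]
  exact Measure.toSphere_ne_zero _

lemma isProbabilityMeasure_uniformSphere {m : ℕ} (hm : 0 < m) :
    IsProbabilityMeasure (uniformSphere m) :=
  ⟨ENNReal.inv_mul_cancel (toSphere_univ_ne_zero hm) (measure_ne_top _ _)⟩

/-- The band of points of the unit sphere whose height above the equator `xᗮ` is at most `ε`. -/
def band {m : ℕ} (x : EuclideanSpace ℝ (Fin m)) (ε : ℝ) :
    Set (Metric.sphere (0 : EuclideanSpace ℝ (Fin m)) 1) :=
  {s | |inner ℝ (s : EuclideanSpace ℝ (Fin m)) x| ≤ ε}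

lemma isClosed_band {m : ℕ} (x : EuclideanSpace ℝ (Fin m)) (ε : ℝ) : IsClosed (band x ε) :=
  isClosed_le (by fun_prop) continuous_const

lemma uniformSphere_apply {m : ℕ} {s : Set (Metric.sphere (0 : EuclideanSpace ℝ (Fin m)) 1)}
    (hs : MeasurableSet s) :
    uniformSphere m s = ((volume : Measure (EuclideanSpace ℝ (Fin m))).toSphere Set.univ)⁻¹ *
      (m * volume (Set.Ioo (0 : ℝ) 1 • ((↑) '' s : Set (EuclideanSpace ℝ (Fin m))))) := by
  rw [uniformSphere, Measure.smul_apply, Measure.toSphere_apply' _ hs, finrank_euclideanSpace_fin,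
    smul_eq_mul]

lemma exists_uniformSphere_band_le {m : ℕ} (hm : 0 < m) :
    ∃ C : ℝ, 0 < C ∧ ∀ x : EuclideanSpace ℝ (Fin m), ‖x‖ = 1 → ∀ ε : ℝ, 0 ≤ ε →
      uniformSphere m (band x ε) ≤ ENNReal.ofReal (C * ε) := by
  set V := (volume : Measure (EuclideanSpace ℝ (Fin m))).toSphere Set.univ with hV
  have hV0 : V ≠ 0 := toSphere_univ_ne_zero hm
  have hVt : V ≠ ⊤ := measure_ne_top _ _
  have hVr : 0 < V.toReal := ENNReal.toReal_pos hV0 hVt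
  refine ⟨V.toReal⁻¹ * (m * 2 ^ m), by positivity, fun x hx ε hε => ?_⟩
  obtain ⟨b, hb⟩ := exists_orthonormalBasis_apply_eq hx ⟨0, hm⟩
  -- The cone over the band fits in a box of half-width `ε` along `x` and `1` in the other
  -- directions.
  have hsub : Set.Ioo (0 : ℝ) 1 • ((↑) '' band x ε : Set (EuclideanSpace ℝ (Fin m))) ⊆
      {y | ∀ i, inner ℝ (b i) y ∈ Set.Icc (if i = ⟨0, hm⟩ then -ε else -1)
        (if i = ⟨0, hm⟩ then ε else 1)} := by
    rintro _ ⟨r, hr, _, ⟨s, hs, rfl⟩, rfl⟩ i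
    have hs1 : ‖(s : EuclideanSpace ℝ (Fin m))‖ = 1 := by simp
    have hbs : |inner ℝ (b i) (s : EuclideanSpace ℝ (Fin m))| ≤ 1 := by
      refine (abs_real_inner_le_norm _ _).trans ?_
      rw [b.norm_eq_one, hs1, one_mul]
    have hs2 : |inner ℝ (s : EuclideanSpace ℝ (Fin m)) x| ≤ ε := hs
    have key : ∀ z B : ℝ, |z| ≤ B → r * z ∈ Set.Icc (-B) B := fun z B h => by
      rw [Set.mem_Icc, ← abs_le, abs_mul, abs_of_pos hr.1]
      exact (mul_le_of_le_one_left (abs_nonneg _) hr.2.le).trans h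
    simp only [inner_smul_right]
    split_ifs with hi
    · rw [hi, hb, real_inner_comm]
      exact key _ _ hs2
    · exact key _ _ hbs
  have hvol := measure_mono (μ := volume) hsub
  rw [volume_orthonormalBasis_box] at hvol
  have hprod : ∏ i : Fin m, ENNReal.ofReal ((if i = ⟨0, hm⟩ then ε else 1) -
      (if i = ⟨0, hm⟩ then -ε else -1)) = ENNReal.ofReal (2 ^ m * ε) := by
    rw [← ENNReal.ofReal_prod_of_nonneg (fun i _ => by split_ifs <;> linarith)]
    congr 1
    have h1 : ∀ i : Fin m, ((if i = ⟨0, hm⟩ then ε else 1) -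
        (if i = ⟨0, hm⟩ then -ε else -1)) = 2 * (if i = ⟨0, hm⟩ then ε else 1) := fun i => by
      split_ifs <;> ring
    simp_rw [h1]
    rw [Finset.prod_mul_distrib]
    simp
  rw [hprod] at hvol
  rw [uniformSphere_apply (isClosed_band x ε).measurableSet]
  calc V⁻¹ * (m * volume (Set.Ioo (0 : ℝ) 1 • ((↑) '' band x ε : Set (EuclideanSpace ℝ (Fin m)))))
      ≤ V⁻¹ * (m * ENNReal.ofReal (2 ^ m * ε)) := by gcongr
    _ = ENNReal.ofReal (V.toReal⁻¹ * (m * 2 ^ m) * ε) := by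
      rw [← ENNReal.ofReal_toReal hVt, ENNReal.toReal_ofReal hVr.le,
        ← ENNReal.ofReal_inv_of_pos hVr, ← ENNReal.ofReal_natCast,
        ← ENNReal.ofReal_mul (by positivity), ← ENNReal.ofReal_mul (by positivity)]
      congr 1; ring

lemma exists_le_uniformSphere_band {m : ℕ} (hm : 2 ≤ m) :
    ∃ c : ℝ, 0 < c ∧ ∀ x : EuclideanSpace ℝ (Fin m), ‖x‖ = 1 → ∀ ε : ℝ, 0 ≤ ε → ε ≤ 1 →
      ENNReal.ofReal (c * ε) ≤ uniformSphere m (band x ε) := by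
  have hm0 : 0 < m := by omega
  have hmr : (2 : ℝ) ≤ m := by exact_mod_cast hm
  set V := (volume : Measure (EuclideanSpace ℝ (Fin m))).toSphere Set.univ with hV
  have hV0 : V ≠ 0 := toSphere_univ_ne_zero hm0
  have hVt : V ≠ ⊤ := measure_ne_top _ _
  have hVr : 0 < V.toReal := ENNReal.toReal_pos hV0 hVt
  refine ⟨V.toReal⁻¹ * (m * ((2 * m : ℝ)⁻¹ ^ m * 2)), by positivity, fun x hx ε hε hε1 => ?_⟩
  obtain ⟨b, hb⟩ := exists_orthonormalBasis_apply_eq hx ⟨0, hm0⟩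
  -- With `κ = 1/(2m)`, a coordinate other than the one along `x` (there is one as `m ≥ 2`) forces
  -- `‖y‖ ≥ κ`, so normalizing turns `εκ` into at most `ε`; all coordinates being at most `2κ = 1/m`
  -- in absolute value gives `‖y‖ < 1`.
  have hsub : {y | ∀ i, inner ℝ (b i) y ∈ Set.Icc
        (if i = ⟨0, hm0⟩ then -(ε * (2 * m : ℝ)⁻¹) else (2 * m : ℝ)⁻¹)
        (if i = ⟨0, hm0⟩ then ε * (2 * m : ℝ)⁻¹ else 2 * (2 * m : ℝ)⁻¹)} ⊆
      Set.Ioo (0 : ℝ) 1 • ((↑) '' band x ε : Set (EuclideanSpace ℝ (Fin m))) := by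
    intro y hy
    have hκ : 0 < (2 * m : ℝ)⁻¹ := by positivity
    have hκm : m * (2 * (2 * m : ℝ)⁻¹) ^ 2 < 1 := by
      have h1 : m * (2 * (2 * m : ℝ)⁻¹) ^ 2 = (m : ℝ)⁻¹ := by field_simp
      rw [h1]
      exact inv_lt_one_of_one_lt₀ (by linarith)
    set κ : ℝ := (2 * m : ℝ)⁻¹ with hκdef
    have hy0 : |inner ℝ x y| ≤ ε * κ := by
      have := hy ⟨0, hm0⟩
      simpa [hb, abs_le] using this
    have hy1 : κ ≤ ‖y‖ := by
      have := hy ⟨1, hm⟩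
      simp only [Fin.mk.injEq, one_ne_zero, if_false] at this
      refine this.1.trans ((real_inner_le_norm _ _).trans ?_)
      rw [b.norm_eq_one, one_mul]
    have hyi : ∀ i, inner ℝ (b i) y ^ 2 ≤ (2 * κ) ^ 2 := fun i => by
      have := hy i
      rw [sq_le_sq, abs_of_pos (by positivity : 0 < 2 * κ), abs_le]
      split_ifs at this with hi
      · constructor <;> nlinarith [this.1, this.2]
      · constructor <;> nlinarith [this.1, this.2]
    have hyn : ‖y‖ < 1 := by
      have h1 : ‖y‖ ^ 2 ≤ m * (2 * κ) ^ 2 := by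
        rw [← b.sum_sq_inner_right y]
        refine (Finset.sum_le_card_nsmul _ _ _ fun i _ => hyi i).trans ?_
        simp
      nlinarith [norm_nonneg y]
    have hypos : 0 < ‖y‖ := hκ.trans_le hy1
    have hy' : y ≠ 0 := norm_pos_iff.1 hypos
    refine ⟨‖y‖, ⟨hypos, hyn⟩, (‖y‖⁻¹ : ℝ) • y,
      ⟨⟨_, by simpa using norm_smul_inv_norm (𝕜 := ℝ) hy'⟩, ?_, rfl⟩, ?_⟩
    · change |inner ℝ ((‖y‖⁻¹ : ℝ) • y) x| ≤ ε
      rw [real_inner_comm, inner_smul_right, abs_mul, abs_of_pos (inv_pos.2 hypos),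
        inv_mul_le_iff₀ hypos]
      nlinarith
    · simp [smul_smul, hypos.ne']
  have hvol := measure_mono (μ := volume) hsub
  rw [volume_orthonormalBasis_box] at hvol
  have hprod : ∏ i : Fin m, ENNReal.ofReal
      ((if i = ⟨0, hm0⟩ then ε * (2 * m : ℝ)⁻¹ else 2 * (2 * m : ℝ)⁻¹) -
      (if i = ⟨0, hm0⟩ then -(ε * (2 * m : ℝ)⁻¹) else (2 * m : ℝ)⁻¹)) =
      ENNReal.ofReal ((2 * m : ℝ)⁻¹ ^ m * 2 * ε) := by
    have h1 : ∀ i : Fin m, (if i = ⟨0, hm0⟩ then ε * (2 * m : ℝ)⁻¹ else 2 * (2 * m : ℝ)⁻¹) -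
        (if i = ⟨0, hm0⟩ then -(ε * (2 * m : ℝ)⁻¹) else (2 * m : ℝ)⁻¹) =
        (2 * m : ℝ)⁻¹ * (if i = ⟨0, hm0⟩ then 2 * ε else 1) := fun i => by
      split_ifs <;> ring
    simp_rw [h1]
    rw [← ENNReal.ofReal_prod_of_nonneg (fun i _ => by split_ifs <;> positivity)]
    congr 1
    rw [Finset.prod_mul_distrib]
    simp
    ring
  rw [hprod] at hvol
  rw [uniformSphere_apply (isClosed_band x ε).measurableSet]
  calc ENNReal.ofReal (V.toReal⁻¹ * (m * ((2 * m : ℝ)⁻¹ ^ m * 2)) * ε)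
      = V⁻¹ * (m * ENNReal.ofReal ((2 * m : ℝ)⁻¹ ^ m * 2 * ε)) := by
          rw [← ENNReal.ofReal_toReal hVt, ENNReal.toReal_ofReal hVr.le,
            ← ENNReal.ofReal_inv_of_pos hVr, ← ENNReal.ofReal_natCast,
            ← ENNReal.ofReal_mul (by positivity), ← ENNReal.ofReal_mul (by positivity)]
          congr 1; ring
    _ ≤ V⁻¹ * (m * volume (Set.Ioo (0 : ℝ) 1 •
        ((↑) '' band x ε : Set (EuclideanSpace ℝ (Fin m))))) := by gcongr

/-- For `s = -1`, the cone over the reflected set is the reflected cone, and Lebesgue measure is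
symmetric. -/
lemma measurePreserving_units_smul {m : ℕ} (s : ℤˣ) :
    ∃ f : Metric.sphere (0 : EuclideanSpace ℝ (Fin m)) 1 →
        Metric.sphere (0 : EuclideanSpace ℝ (Fin m)) 1,
      MeasurePreserving f (uniformSphere m) (uniformSphere m) ∧
      ∀ v, (f v : EuclideanSpace ℝ (Fin m)) = s • (v : EuclideanSpace ℝ (Fin m)) := by
  rcases Int.units_eq_one_or s with rfl | rfl
  · exact ⟨id, .id _, by simp⟩
  refine ⟨fun v => -v, ⟨continuous_neg.measurable, ?_⟩, by simp⟩
  ext t ht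
  rw [Measure.map_apply continuous_neg.measurable ht, uniformSphere_apply ht,
    uniformSphere_apply (continuous_neg.measurable ht)]
  congr 2
  rw [← Measure.measure_neg]
  congr 1
  ext y
  simp only [Set.mem_neg, Set.mem_smul, Set.mem_image, Set.mem_preimage]
  constructor
  · rintro ⟨r, hr, _, ⟨v, hv, rfl⟩, hy⟩
    exact ⟨r, hr, _, ⟨-v, hv, rfl⟩, by simp [hy]⟩
  · rintro ⟨r, hr, _, ⟨v, hv, rfl⟩, hy⟩
    exact ⟨r, hr, _, ⟨-v, by simpa using hv, rfl⟩, by simp [hy]⟩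

/-! ### Conditioning on all coordinates but one. -/

section pi

variable {ι : Type*} [Fintype ι] [DecidableEq ι] {X : ι → Type*} [∀ i, MeasurableSpace (X i)]
  (μ : ∀ i, Measure (X i)) [∀ i, IsProbabilityMeasure (μ i)]

lemma lintegral_pi_const_erase (i : ι) (c : ENNReal) (x : ∀ i, X i) :
    (∫⋯∫⁻_(Finset.univ.erase i), (fun _ => c) ∂μ) x = c := by
  simp [lmarginal]

lemma measure_pi_le_of_section_le {F : Set (∀ i, X i)} (hF : MeasurableSet F) (i : ι)
    {r : ENNReal} (h : ∀ x, μ i {y | Function.update x i y ∈ F} ≤ r) :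
    Measure.pi μ F ≤ r := by
  have hne : Nonempty (∀ i, X i) := nonempty_of_isProbabilityMeasure (Measure.pi μ)
  obtain ⟨x⟩ := hne
  rw [← lintegral_indicator_one hF, lintegral_eq_lmarginal_univ x,
    lmarginal_erase' _ (measurable_one.indicator hF) (Finset.mem_univ i)]
  refine (lmarginal_mono (g := fun _ => r) (fun z => ?_) x).trans_eq
    (lintegral_pi_const_erase μ i r x)
  exact le_trans (lintegral_indicator_one (μ := μ i) (measurable_update (a := i) z hF)).le (h z)

lemma le_measure_pi_of_le_section {F : Set (∀ i, X i)} (hF : MeasurableSet F) (i : ι)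
    {r : ENNReal} (h : ∀ x, r ≤ μ i {y | Function.update x i y ∈ F}) :
    r ≤ Measure.pi μ F := by
  have hne : Nonempty (∀ i, X i) := nonempty_of_isProbabilityMeasure (Measure.pi μ)
  obtain ⟨x⟩ := hne
  rw [← lintegral_indicator_one hF, lintegral_eq_lmarginal_univ x,
    lmarginal_erase' _ (measurable_one.indicator hF) (Finset.mem_univ i)]
  refine (lintegral_pi_const_erase μ i r x).symm.trans_le
    (lmarginal_mono (f := fun _ => r) (fun z => ?_) x)
  exact (h z).trans (lintegral_indicator_one (μ := μ i) (measurable_update (a := i) z hF)).ge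

end pi

lemma exists_norm_eq_one_inner_eq_zero {m : ℕ} {ι : Type*} (s : Finset ι) (hs : s.card < m)
    (v : ι → EuclideanSpace ℝ (Fin m)) :
    ∃ u : EuclideanSpace ℝ (Fin m), ‖u‖ = 1 ∧ ∀ i ∈ s, inner ℝ (v i) u = 0 := by
  classical
  set W := Submodule.span ℝ ((s.image v : Finset _) : Set (EuclideanSpace ℝ (Fin m))) with hW
  have hfin : Module.finrank ℝ W < m :=
    ((finrank_span_finset_le_card _).trans Finset.card_image_le).trans_lt hs
  have hne : Wᗮ ≠ ⊥ := fun h => by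
    rw [Submodule.orthogonal_eq_bot_iff] at h
    rw [h, finrank_top, finrank_euclideanSpace_fin] at hfin
    exact lt_irrefl _ hfin
  obtain ⟨u, hu, hu0⟩ := Submodule.exists_mem_ne_zero_of_ne_bot hne
  refine ⟨(‖u‖⁻¹ : ℝ) • u, norm_smul_inv_norm (𝕜 := ℝ) hu0, fun i hi => ?_⟩
  have hvi : v i ∈ W := Submodule.subset_span (Finset.mem_coe.2 (Finset.mem_image_of_mem v hi))
  rw [inner_smul_right, Submodule.inner_right_of_mem_orthogonal hvi hu, mul_zero]

/-- Projection along a compact factor is closed; this supplies measurability of events with an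
existential quantifier. -/
lemma isClosed_exists_of_compact {X Y : Type*} [TopologicalSpace X] [TopologicalSpace Y]
    [CompactSpace X] {p : X → Y → Prop} (h : IsClosed {z : X × Y | p z.1 z.2}) :
    IsClosed {y | ∃ x, p x y} := by
  convert isClosedMap_snd_of_compactSpace _ h
  ext y
  simp

lemma isClosed_nearIllPosed {n m : ℕ} (δ : ℝ) :
    IsClosed {a : Fin n → Metric.sphere (0 : EuclideanSpace ℝ (Fin m)) 1 |
      NearIllPosed (fun i => (a i : EuclideanSpace ℝ (Fin m))) δ} := by
  have h₁ := isClosed_exists_of_compact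
    (X := Metric.sphere (0 : EuclideanSpace ℝ (Fin m)) 1)
    (Y := Fin n → Metric.sphere (0 : EuclideanSpace ℝ (Fin m)) 1)
    (p := fun x a => ∀ i, inner ℝ (a i : EuclideanSpace ℝ (Fin m)) (x : EuclideanSpace ℝ (Fin m))
      ≤ δ) (by
      simp only [Set.ofPred_forall]
      exact isClosed_iInter fun i => isClosed_le (by fun_prop) continuous_const)
  have h₂ : IsClosed {a : Fin n → Metric.sphere (0 : EuclideanSpace ℝ (Fin m)) 1 |
      ∀ y : EuclideanSpace ℝ (Fin m), ‖y‖ = 1 →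
        ∃ i, -δ ≤ inner ℝ (a i : EuclideanSpace ℝ (Fin m)) y} := by
    simp only [Set.ofPred_forall, Set.ofPred_exists]
    exact isClosed_iInter fun y => isClosed_iInter fun _ =>
      isClosed_iUnion_of_finite fun i => isClosed_le continuous_const (by fun_prop)
  convert h₁.inter h₂ using 1
  ext a
  simp [NearIllPosed]

/-! ### Linear bounds for the probability of near ill-posedness. -/

lemma exists_pi_nearIllPosed_le {n m : ℕ} (hm : 0 < m) (hn : 0 < n) :
    ∃ C : ℝ, 0 < C ∧ ∀ δ : ℝ, 0 < δ → Measure.pi (fun _ : Fin n => uniformSphere m)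
      {a | NearIllPosed (fun i => (a i : EuclideanSpace ℝ (Fin m))) δ} ≤
        ENNReal.ofReal (C * δ) := by
  have := isProbabilityMeasure_uniformSphere hm
  obtain ⟨C, hC, hband⟩ := exists_uniformSphere_band_le hm
  have : NeZero n := ⟨hn.ne'⟩
  refine ⟨Fintype.card (Fin n × Finset (Fin n)) * (C * (2 * m)), by positivity,
    fun δ hδ => ?_⟩
  let F : Fin n × Finset (Fin n) → Set (Fin n → Metric.sphere (0 : EuclideanSpace ℝ (Fin m)) 1) :=
    fun q => {a | (q.1 ∉ q.2 ∧ q.2.card < m) ∧ ∃ c : Fin n → Set.Icc (0 : ℝ) 1,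
      ‖(a q.1 : EuclideanSpace ℝ (Fin m)) +
        ∑ i ∈ q.2, (c i : ℝ) • (a i : EuclideanSpace ℝ (Fin m))‖ ≤ 2 * m * δ}
  have hF : ∀ q, Measure.pi (fun _ : Fin n => uniformSphere m) (F q) ≤
      ENNReal.ofReal (C * (2 * m * δ)) := by
    rintro ⟨j, s⟩
    by_cases hq : j ∉ s ∧ s.card < m
    · have hclosed : IsClosed (F (j, s)) := by
        refine IsClosed.inter isClosed_const (isClosed_exists_of_compact ?_)
        exact isClosed_le (by fun_prop) continuous_const
      refine measure_pi_le_of_section_le _ hclosed.measurableSet j fun z => ?_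
      -- Since `j ∉ s`, the direction `u` depends only on the frozen vectors; pairing with `u`
      -- removes the sum and leaves a band condition on `y`.
      obtain ⟨u, hu, hus⟩ := exists_norm_eq_one_inner_eq_zero s hq.2
        (fun i => (z i : EuclideanSpace ℝ (Fin m)))
      refine (measure_mono ?_).trans (hband u hu (2 * m * δ) (by positivity))
      rintro y ⟨-, c, hc⟩
      have hsum : ∑ i ∈ s, (c i : ℝ) •
          (Function.update z j y i : EuclideanSpace ℝ (Fin m)) =
          ∑ i ∈ s, (c i : ℝ) • (z i : EuclideanSpace ℝ (Fin m)) :=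
        Finset.sum_congr rfl fun i hi => by
          rw [Function.update_of_ne (by rintro rfl; exact hq.1 hi)]
      simp only [hsum, Function.update_self] at hc
      have hz : inner ℝ (∑ i ∈ s, (c i : ℝ) • (z i : EuclideanSpace ℝ (Fin m))) u = 0 := by
        rw [sum_inner]
        exact Finset.sum_eq_zero fun i hi => by rw [real_inner_smul_left, hus i hi, mul_zero]
      have hb := abs_real_inner_le_norm ((y : EuclideanSpace ℝ (Fin m)) +
        ∑ i ∈ s, (c i : ℝ) • (z i : EuclideanSpace ℝ (Fin m))) u
      rw [inner_add_left, hz, add_zero, hu, mul_one] at hb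
      exact hb.trans hc
    · have hempty : F (j, s) = ∅ := Set.eq_empty_of_forall_notMem fun a ha => hq ha.1
      simp [hempty]
  have hsub : {a : Fin n → Metric.sphere (0 : EuclideanSpace ℝ (Fin m)) 1 |
      NearIllPosed (fun i => (a i : EuclideanSpace ℝ (Fin m))) δ} ⊆ ⋃ q, F q := fun a ha => by
    obtain ⟨j, s, hj, hs, c, hc⟩ := NearIllPosed.exists_norm_add_sum_le hn hδ ha
    exact Set.mem_iUnion.2 ⟨(j, s), ⟨hj, hs⟩, c, hc⟩
  calc Measure.pi (fun _ : Fin n => uniformSphere m) _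
      ≤ ∑ q, Measure.pi (fun _ : Fin n => uniformSphere m) (F q) :=
        (measure_mono hsub).trans (measure_iUnion_fintype_le _ _)
    _ ≤ ∑ _q : Fin n × Finset (Fin n), ENNReal.ofReal (C * (2 * m * δ)) :=
        Finset.sum_le_sum fun q _ => hF q
    _ = _ := by
        rw [Finset.sum_const, nsmul_eq_mul, Finset.card_univ, ← ENNReal.ofReal_natCast,
          ← ENNReal.ofReal_mul (by positivity)]
        congr 1; ring

lemma exists_le_pi_nearIllPosed {n m : ℕ} (hm : 2 ≤ m) (hmn : m ≤ n) :
    ∃ c : ℝ, 0 < c ∧ ∀ ε : ℝ, 0 ≤ ε → ε ≤ 1 → ENNReal.ofReal (c * ε) ≤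
      Measure.pi (fun _ : Fin n => uniformSphere m)
        {a | NearIllPosed (fun i => (a i : EuclideanSpace ℝ (Fin m))) ε} := by
  have := isProbabilityMeasure_uniformSphere (m := m) (by omega)
  obtain ⟨c, hc, hband⟩ := exists_le_uniformSphere_band hm
  set N : ℕ := Fintype.card (Fin n → ℤˣ) with hN
  have hN0 : 0 < N := Fintype.card_pos
  refine ⟨(N : ℝ)⁻¹ * c, by positivity, fun ε hε hε1 => ?_⟩
  set μ := Measure.pi (fun _ : Fin n => uniformSphere m) with hμ
  set G : Set (Fin n → Metric.sphere (0 : EuclideanSpace ℝ (Fin m)) 1) :=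
    {a | NearIllPosed (fun i => (a i : EuclideanSpace ℝ (Fin m))) ε} with hG
  let F : Set (Fin n → Metric.sphere (0 : EuclideanSpace ℝ (Fin m)) 1) :=
    {a | ∃ x : Metric.sphere (0 : EuclideanSpace ℝ (Fin m)) 1, ∀ i : Fin m,
      |inner ℝ (a (Fin.castLE hmn i) : EuclideanSpace ℝ (Fin m)) (x : EuclideanSpace ℝ (Fin m))|
        ≤ ε}
  have hFclosed : IsClosed F := by
    refine isClosed_exists_of_compact ?_
    simp only [Set.ofPred_forall]
    exact isClosed_iInter fun i => isClosed_le (by fun_prop) continuous_const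
  have hFlow : ENNReal.ofReal (c * ε) ≤ μ F := by
    let k : Fin m := ⟨m - 1, by omega⟩
    refine le_measure_pi_of_le_section _ hFclosed.measurableSet (Fin.castLE hmn k) fun z => ?_
    -- `u` is normal to the other `m - 1` of the first `m` vectors, so only the resampled vector
    -- needs to be in the band.
    obtain ⟨u, hu, hus⟩ := exists_norm_eq_one_inner_eq_zero (Finset.univ.erase k)
      (by rw [Finset.card_erase_of_mem (Finset.mem_univ _)]; simp; omega)
      (fun i => (z (Fin.castLE hmn i) : EuclideanSpace ℝ (Fin m)))
    refine (hband u hu ε hε hε1).trans (measure_mono fun y hy => ⟨⟨u, by simpa using hu⟩, ?_⟩)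
    intro i
    by_cases hi : i = k
    · rw [hi, Function.update_self]; exact hy
    · rw [Function.update_of_ne (fun h => hi (Fin.castLE_injective hmn h)),
        hus i (Finset.mem_erase.2 ⟨hi, Finset.mem_univ _⟩), abs_zero]
      exact hε
  choose f hf hfs using fun s : ℤˣ => measurePreserving_units_smul (m := m) s
  have hsub : F ⊆ ⋃ s : Fin n → ℤˣ, (fun a i => f (s i) (a i)) ⁻¹' G := by
    rintro a ⟨x, hx⟩
    obtain ⟨s, hs⟩ := exists_nearIllPosed_smul hmn (fun i => (a i : EuclideanSpace ℝ (Fin m)))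
      (x := x) (by simp) hε hx
    refine Set.mem_iUnion.2 ⟨s, ?_⟩
    simpa only [hG, Set.mem_preimage, Set.mem_ofPred_eq, hfs] using hs
  have hpre : ∀ s : Fin n → ℤˣ, μ ((fun a i => f (s i) (a i)) ⁻¹' G) = μ G := fun s =>
    (measurePreserving_pi _ _ fun i => hf (s i)).measure_preimage
      (isClosed_nearIllPosed ε).measurableSet.nullMeasurableSet
  have hle : ENNReal.ofReal (c * ε) ≤ N * μ G := by
    refine hFlow.trans ((measure_mono hsub).trans ((measure_iUnion_fintype_le _ _).trans ?_))
    simp only [hpre, Finset.sum_const, nsmul_eq_mul, Finset.card_univ, hN]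
    exact le_rfl
  rw [mul_assoc, ENNReal.ofReal_mul (by positivity), ENNReal.ofReal_inv_of_pos (by positivity),
    ENNReal.ofReal_natCast]
  exact (ENNReal.inv_mul_le_iff (by positivity) (ENNReal.natCast_ne_top _)).2 hle

/-! ### From two-sided bounds to the decay rate. -/

lemma tendsto_log_div_of_exp_bounds {f : ℝ → ℝ} {c C : ℝ} (hc : 0 < c)
    (h : ∀ᶠ t in atTop, c * Real.exp (-t) ≤ f t ∧ f t ≤ C * Real.exp (-t)) :
    Tendsto (fun t => Real.log (f t) / t) atTop (𝓝 (-1)) := by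
  have hlim : ∀ K : ℝ, Tendsto (fun t : ℝ => Real.log K / t - 1) atTop (𝓝 (-1)) := fun K => by
    simpa using (tendsto_const_nhds (x := Real.log K)).div_atTop tendsto_id |>.sub_const 1
  have hlog : ∀ K t : ℝ, 0 < K → 0 < t →
      Real.log K / t - 1 = Real.log (K * Real.exp (-t)) / t := fun K t hK ht => by
    rw [Real.log_mul hK.ne' (Real.exp_pos _).ne', Real.log_exp]
    field_simp
    ring
  refine tendsto_of_tendsto_of_tendsto_of_le_of_le' (hlim c) (hlim C) ?_ ?_
  · filter_upwards [h, eventually_gt_atTop 0] with t ht ht0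
    rw [hlog c t hc ht0]
    exact div_le_div_of_nonneg_right (Real.log_le_log (by positivity) ht.1) ht0.le
  · filter_upwards [h, eventually_gt_atTop 0] with t ht ht0
    have hf : 0 < f t := lt_of_lt_of_le (by positivity) ht.1
    have hC : 0 < C := pos_of_mul_pos_left (hf.trans_le ht.2) (Real.exp_pos _).le
    rw [hlog C t hC ht0]
    exact div_le_div_of_nonneg_right (Real.log_le_log hf ht.2) ht0.le

end LinearFeasibility

theorem mainTheorem3 {Ω : Type*} [MeasurableSpace Ω] (P : Measure Ω) [IsProbabilityMeasure P]
    (n m : ℕ) (hm : 2 ≤ m) (hmn : m ≤ n)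
    (A : Ω → Matrix (Fin n) (Fin m) ℝ) (hA : LinearFeasibility.IsUniformRandomMatrix A P) :
    Tendsto
      (fun t : ℝ =>
        Real.log (P.real {ω | (t : EReal) ≤ ENNReal.log (LinearFeasibility.condNumber (A ω))}) / t)
      atTop (𝓝 (-1)) := by
  obtain ⟨a, hrow, hlaw, hind⟩ := hA
  have hm0 : 0 < m := by omega
  have hn0 : 0 < n := by omega
  have : NeZero n := ⟨hn0.ne'⟩
  have hmeas : AEMeasurable (fun ω i => a i ω) P := aemeasurable_pi_lambda _ fun i =>
    (hlaw i).aemeasurable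
  have hmap : P.map (fun ω i => a i ω) = Measure.pi (fun _ => LinearFeasibility.uniformSphere m) := by
    rw [hind.map_fun_eq_pi_map fun i => (hlaw i).aemeasurable]
    simp only [(hlaw _).map_eq]
  have hrow1 : ∀ ω i, ‖LinearFeasibility.row (A ω) i‖ = 1 := fun ω i => by rw [hrow]; simp
  have hP : ∀ δ, P {ω | LinearFeasibility.NearIllPosed (LinearFeasibility.row (A ω)) δ} =
      Measure.pi (fun _ => LinearFeasibility.uniformSphere m)
        {a | LinearFeasibility.NearIllPosed (fun i => (a i : EuclideanSpace ℝ (Fin m))) δ} := fun δ => by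
    rw [← hmap, Measure.map_apply_of_aemeasurable hmeas (LinearFeasibility.isClosed_nearIllPosed δ).measurableSet]
    congr 1
    ext ω
    simp only [Set.mem_ofPred_eq, Set.mem_preimage]
    rw [show LinearFeasibility.row (A ω) = fun i => (a i ω : EuclideanSpace ℝ (Fin m)) from funext (hrow ω)]
  obtain ⟨C, hC, hupper⟩ := LinearFeasibility.exists_pi_nearIllPosed_le (n := n) hm0 hn0
  obtain ⟨c, hc, hlower⟩ := LinearFeasibility.exists_le_pi_nearIllPosed hm hmn
  simp only [LinearFeasibility.le_log_condNumber_iff]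
  have hsmall : ∀ᶠ t : ℝ in atTop, Real.exp (-t) < 1 / 2 :=
    (Real.tendsto_exp_neg_atTop_nhds_zero).eventually (gt_mem_nhds (by norm_num))
  -- The factor `2` makes `|cos θ| ≤ e^{-t}` strict, as `|cos θ| < 2e^{-t}`; `hsmall` keeps this
  -- bound below `1`.
  refine LinearFeasibility.tendsto_log_div_of_exp_bounds (c := c) (C := C * 2) hc ?_
  filter_upwards [hsmall] with t ht
  have hpos := Real.exp_pos (-t)
  constructor
  · rw [measureReal_def, ← ENNReal.ofReal_le_iff_le_toReal (measure_ne_top _ _)]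
    refine (hlower _ hpos.le (by linarith)).trans ?_
    rw [← hP]
    exact measure_mono fun ω hω => LinearFeasibility.NearIllPosed.abs_cos_le (hrow1 ω) hω
  · refine ENNReal.toReal_le_of_le_ofReal (by positivity) ?_
    rw [mul_assoc]
    refine le_trans ?_ (hupper _ (by positivity))
    rw [← hP]
    exact measure_mono fun ω hω => LinearFeasibility.nearIllPosed_of_abs_cos_lt (hrow1 ω) hm0 (by linarith)
      (lt_of_le_of_lt hω (by linarith))
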